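/- Let $n$ be a natural number, let $\mathcal{B}\subseteq\mathbb{C}^n$ be a bounded domain (a nonempty, connected, bounded open set), the "model domain", and fix a point $P_0\in\mathcal{B}$. For a bounded domain $\Omega\subseteq\mathbb{C}^n$ and $z\in\Omega$ put $$\widehat{\mathcal C}_\Omega(z)=\sup\{|\det\varphi'(z)| : \varphi:\Omega\to\mathcal{B}\ \text{holomorphic},\ \varphi(z)=P_0\},$$ $$\widehat{\mathcal K}_\Omega(z)=\inf\Bigl\{\frac{1}{|\det\psi'(P_0)|} : \psi:\mathcal{B}\to\Omega\ \text{holomorphic},\ \psi(P_0)=z\Bigr\}$$ (with $1/0=+\infty$), and $$\widehat{\mathcal M}_\Omega(z)=\frac{\widehat{\mathcal K}_\Omega(z)}{\widehat{\mathcal C}_\Omega(z)}.$$ Let $\Omega\subseteq\mathbb{C}^n$ be a bounded domain. Suppose that there is a point $P\in\Omega$ such that $\widehat{\mathcal M}_\Omega(P)=1$. Then $\Omega$ is biholomorphic to $\mathcal{B}$. -/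

import Mathlib

open Set
open scoped ENNReal

namespace ModelDomain

/-- Complex Euclidean space `ℂⁿ`. -/
abbrev Cn (n : ℕ) : Type := EuclideanSpace ℂ (Fin n)

/-- A bounded domain in `ℂⁿ`: a (nonempty) connected open set that is bounded. -/
structure IsBoundedDomain {n : ℕ} (Ω : Set (Cn n)) : Prop where
  isOpen : IsOpen Ω
  isConnected : IsConnected Ω
  isBounded : Bornology.IsBounded Ω

/-- `HolMaps U V z w`: the holomorphic mappings `φ : U → V` with `φ z = w`
(represented by total functions, of which only the restriction to `U` matters). -/
def HolMaps {n : ℕ} (U V : Set (Cn n)) (z w : Cn n) : Set (Cn n → Cn n) :=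
  {φ | DifferentiableOn ℂ φ U ∧ MapsTo φ U V ∧ φ z = w}

/-- `|det φ'(z)|`, the modulus of the complex Jacobian determinant, as an element of `[0, ∞]`. -/
noncomputable def absJacobian {n : ℕ} (φ : Cn n → Cn n) (z : Cn n) : ℝ≥0∞ :=
  ‖(fderiv ℂ φ z).det‖ₑ

/-- The Carathéodory type volume element of `Ω` at `z` with respect to the model `(𝓑, P₀)`:
the supremum of `|det φ'(z)|` over holomorphic `φ : Ω → 𝓑` with `φ z = P₀`. -/
noncomputable def caratheodoryVol {n : ℕ} (𝓑 : Set (Cn n)) (P₀ : Cn n)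
    (Ω : Set (Cn n)) (z : Cn n) : ℝ≥0∞ :=
  ⨆ φ ∈ HolMaps Ω 𝓑 z P₀, absJacobian φ z

/-- The Kobayashi type volume element of `Ω` at `z` with respect to the model `(𝓑, P₀)`:
the infimum of `1 / |det ψ'(P₀)|` over holomorphic `ψ : 𝓑 → Ω` with `ψ P₀ = z`.
The values are in `[0, ∞]`, where `1 / 0 = ∞`, so degenerate `ψ` do not contribute. -/
noncomputable def kobayashiVol {n : ℕ} (𝓑 : Set (Cn n)) (P₀ : Cn n)
    (Ω : Set (Cn n)) (z : Cn n) : ℝ≥0∞ :=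
  ⨅ ψ ∈ HolMaps 𝓑 Ω P₀ z, 1 / absJacobian ψ P₀

/-- The quotient invariant of `Ω` at `z` with respect to the model `(𝓑, P₀)`. -/
noncomputable def quotientInvariant {n : ℕ} (𝓑 : Set (Cn n)) (P₀ : Cn n)
    (Ω : Set (Cn n)) (z : Cn n) : ℝ≥0∞ :=
  kobayashiVol 𝓑 P₀ Ω z / caratheodoryVol 𝓑 P₀ Ω z

/-- `U` and `V` are biholomorphic: there is a holomorphic bijection `f : U → V`
with holomorphic inverse `g : V → U`. -/
def Biholomorphic {n : ℕ} (U V : Set (Cn n)) : Prop :=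
  ∃ f g : Cn n → Cn n, DifferentiableOn ℂ f U ∧ DifferentiableOn ℂ g V ∧
    MapsTo f U V ∧ MapsTo g V U ∧ InvOn g f U V

end ModelDomain

/-! The value 1 forces the supremum and infimum to agree, so there are maps φ : Ω → 𝓑 and ψ : 𝓑 → Ω
between the base points with |det (ψ ∘ φ)'(P)| as close to 1 as desired. Limits of such maps may
leave the open target, so extremal maps are not available directly; the argument works with
approximating maps instead.

The derivatives at P of the iterates of ψ ∘ φ are bounded by Cauchy's estimate. A power-bounded
operator with |det| ≥ 1 has positive powers near the identity, so replacing φ by φ ∘ (ψ ∘ φ)^k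
brings the derivative of the composite close to 1 (`exists_HolMaps_fderiv_near_one`). An asymptotic
Cartan theorem (`tendsto_self_of_tendsto_fderiv_one`) then makes both composites converge to the
identity. Finally, Hurwitz's theorem for Jacobians keeps the limit maps inside the open domains
(`mapsTo_of_isHolLimit`), so these limits are mutually inverse. -/

namespace ModelDomain

open Filter Metric Topology

/-! ### Cauchy estimates and limits of bounded holomorphic families -/

section Holomorphic

variable {E G : Type*} [NormedAddCommGroup E] [NormedSpace ℂ E]
  [NormedAddCommGroup G] [NormedSpace ℂ G]

/-- Cauchy's estimate for the derivative at the centre of a ball. -/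
theorem norm_fderiv_le_of_norm_le {f : E → G} {c : E} {R M : ℝ} (hR : 0 < R)
    (hf : DifferentiableOn ℂ f (ball c R)) (hM : ∀ z ∈ ball c R, ‖f z‖ ≤ M) :
    ‖fderiv ℂ f c‖ ≤ 2 * M / R := by
  refine Complex.norm_fderiv_le_div_of_mapsTo_ball hf (fun z hz => ?_) hR
  rw [mem_closedBall, dist_eq_norm]
  linarith [norm_sub_le (f z) (f c), hM z hz, hM c (mem_ball_self hR)]

theorem norm_fderiv_le_of_mem_half_ball {f : E → G} {c x : E} {R M : ℝ} (hR : 0 < R)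
    (hf : DifferentiableOn ℂ f (ball c R)) (hM : ∀ z ∈ ball c R, ‖f z‖ ≤ M)
    (hx : x ∈ ball c (R / 2)) : ‖fderiv ℂ f x‖ ≤ 4 * M / R := by
  have hsub : ball x (R / 2) ⊆ ball c R :=
    ball_subset_ball' (by linarith [mem_ball.1 hx])
  refine (norm_fderiv_le_of_norm_le (half_pos hR) (hf.mono hsub)
    fun z hz => hM z (hsub hz)).trans_eq ?_
  field_simp
  ring

theorem norm_sub_le_of_mem_half_ball {f : E → G} {c x y : E} {R M : ℝ} (hR : 0 < R)
    (hf : DifferentiableOn ℂ f (ball c R)) (hM : ∀ z ∈ ball c R, ‖f z‖ ≤ M)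
    (hx : x ∈ ball c (R / 2)) (hy : y ∈ ball c (R / 2)) :
    ‖f x - f y‖ ≤ 4 * M / R * ‖x - y‖ := by
  let : NormedSpace ℝ E := NormedSpace.restrictScalars ℝ ℂ E
  refine (convex_ball c (R / 2)).norm_image_sub_le_of_norm_fderiv_le (𝕜 := ℂ) (fun z hz => ?_)
    (fun z hz => norm_fderiv_le_of_mem_half_ball hR hf hM hz) hy hx
  exact hf.differentiableAt (isOpen_ball.mem_nhds (ball_subset_ball (by linarith) hz))

/-- Cauchy's estimate applied to z ↦ f (z + (x - y)) - f z, which the Lipschitz bound makes of size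
O(‖x - y‖). No second derivative of f is needed. -/
theorem norm_fderiv_sub_le_of_mem_quarter_ball {f : E → G} {c x y : E} {R M : ℝ} (hR : 0 < R)
    (hf : DifferentiableOn ℂ f (ball c R)) (hM : ∀ z ∈ ball c R, ‖f z‖ ≤ M)
    (hx : x ∈ ball c (R / 4)) (hy : y ∈ ball c (R / 4)) :
    ‖fderiv ℂ f x - fderiv ℂ f y‖ ≤ 32 * M / R ^ 2 * ‖x - y‖ := by
  have h1 : ∀ z ∈ ball y (R / 4), z ∈ ball c (R / 2) := fun z hz =>
    ball_subset_ball' (by linarith [mem_ball.1 hy]) hz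
  have h2 : ∀ z ∈ ball y (R / 4), z + (x - y) ∈ ball c (R / 2) := fun z hz => by
    rw [mem_ball, dist_eq_norm] at hz hx ⊢
    calc ‖z + (x - y) - c‖ = ‖(z - y) + (x - c)‖ := by congr 1; abel
      _ ≤ ‖z - y‖ + ‖x - c‖ := norm_add_le _ _
      _ < R / 2 := by linarith
  have hd : ∀ z ∈ ball c (R / 2), DifferentiableAt ℂ f z := fun z hz =>
    hf.differentiableAt (isOpen_ball.mem_nhds (ball_subset_ball (by linarith) hz))
  have hds : ∀ z ∈ ball y (R / 4), DifferentiableAt ℂ (fun z => f (z + (x - y))) z := fun z hz =>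
    (hd _ (h2 z hz)).comp z (f := fun z => z + (x - y)) (by fun_prop)
  have hy' : y ∈ ball y (R / 4) := mem_ball_self (by linarith)
  have key := norm_fderiv_le_of_norm_le (f := fun z => f (z + (x - y)) - f z) (c := y)
    (R := R / 4) (M := 4 * M / R * ‖x - y‖) (by linarith)
    (fun z hz => ((hds z hz).sub (hd z (h1 z hz))).differentiableWithinAt)
    (fun z hz => by
      simpa using norm_sub_le_of_mem_half_ball hR hf hM (h2 z hz) (h1 z hz))
  rw [fderiv_fun_sub (hds y hy') (hd y (h1 y hy')), fderiv_comp_add_right,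
    add_sub_cancel] at key
  refine key.trans_eq ?_
  field_simp
  ring

/-- Pointwise convergence of a family that is equi-Lipschitz near every point of an open set is
locally uniform. -/
theorem tendstoLocallyUniformlyOn_of_lipschitz [FiniteDimensional ℂ E] {H ι : Type*}
    [NormedAddCommGroup H] {l : Filter ι} [l.NeBot] {U : Set E} (hU : IsOpen U)
    {f : ι → E → H} {g : E → H}
    (hlip : ∀ c ∈ U, ∃ r > 0, ∃ K : ℝ, 0 ≤ K ∧ ∀ i, ∀ x ∈ ball c r, ∀ y ∈ ball c r,
      ‖f i x - f i y‖ ≤ K * ‖x - y‖)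
    (hfg : ∀ x ∈ U, Tendsto (fun i => f i x) l (𝓝 (g x))) :
    TendstoLocallyUniformlyOn f g l U := by
  rw [Metric.tendstoLocallyUniformlyOn_iff]
  intro ε hε c hc
  obtain ⟨r, hr, K, hK, hl⟩ := hlip c hc
  obtain ⟨s, hs, hsU⟩ := Metric.isOpen_iff.1 hU c hc
  -- Each of the three error terms below is to be at most ε / 4; `K + 1` allows K = 0.
  have hδ : 0 < min (min r s) (ε / (4 * (K + 1))) := by positivity
  set δ := min (min r s) (ε / (4 * (K + 1))) with hδdef
  have hδr : δ ≤ r := (min_le_left _ _).trans (min_le_left _ _)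
  have hδs : δ ≤ s := (min_le_left _ _).trans (min_le_right _ _)
  have hδK : K * δ ≤ ε / 4 := by
    have : δ ≤ ε / (4 * (K + 1)) := min_le_right _ _
    rw [le_div_iff₀ (by positivity)] at this
    nlinarith
  refine ⟨ball c δ, mem_nhdsWithin_of_mem_nhds (ball_mem_nhds c hδ), ?_⟩
  have hi : ∀ i, ∀ x ∈ ball c δ, ‖f i x - f i c‖ ≤ ε / 4 := fun i x hx => by
    refine (hl i x (ball_subset_ball hδr hx) c (mem_ball_self hr)).trans (le_trans ?_ hδK)
    rw [mem_ball, dist_eq_norm] at hx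
    gcongr
  have hg : ∀ x ∈ ball c δ, ‖g x - g c‖ ≤ ε / 4 := fun x hx =>
    le_of_tendsto (((hfg x (hsU (ball_subset_ball hδs hx))).sub (hfg c hc)).norm)
      (Eventually.of_forall fun i => hi i x hx)
  filter_upwards [Metric.tendsto_nhds.1 (hfg c hc) (ε / 4) (by positivity)] with i h0 x hx
  rw [dist_eq_norm] at h0 ⊢
  calc ‖g x - f i x‖ = ‖(g x - g c) - (f i x - f i c) - (f i c - g c)‖ := by congr 1; abel
    _ ≤ ‖g x - g c‖ + ‖f i x - f i c‖ + ‖f i c - g c‖ :=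
      (norm_sub_le _ _).trans (by gcongr; exact norm_sub_le _ _)
    _ < ε := by linarith [hg x hx, hi i x hx]

/-- Along an ultrafilter every bounded family converges, which replaces the diagonal subsequences of
Montel's theorem. -/
theorem exists_tendsto_ultrafilter_of_norm_le [FiniteDimensional ℂ G] {ι : Type*}
    (l : Ultrafilter ι) {M : ℝ} {u : ι → G} (hu : ∀ i, ‖u i‖ ≤ M) :
    ∃ a, Tendsto u l (𝓝 a) := by
  have : ProperSpace G := FiniteDimensional.proper ℂ G
  obtain ⟨a, -, ha⟩ := (isCompact_closedBall (0 : G) M).ultrafilter_le_nhds (l.map u)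
    (le_principal_iff.2 (Filter.mem_map.2 (univ_mem' fun i => by simpa using hu i)))
  exact ⟨a, ha⟩

/-- Properties of a limit of a uniformly bounded family of holomorphic maps. -/
structure IsHolLimit {ι : Type*} (l : Filter ι) (U : Set E) (f : ι → E → G) (g : E → G) :
    Prop where
  differentiableOn : DifferentiableOn ℂ g U
  tendsto : TendstoLocallyUniformlyOn f g l U
  tendsto_fderiv : TendstoLocallyUniformlyOn (fun i => fderiv ℂ (f i)) (fderiv ℂ g) l U

theorem IsHolLimit.tendsto_at {ι : Type*} {l : Filter ι} {U : Set E} {f : ι → E → G} {g : E → G}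
    (h : IsHolLimit l U f g) {z : E} (hz : z ∈ U) : Tendsto (fun i => f i z) l (𝓝 (g z)) :=
  h.tendsto.tendsto_at hz

theorem IsHolLimit.tendsto_fderiv_at {ι : Type*} {l : Filter ι} {U : Set E} {f : ι → E → G}
    {g : E → G} (h : IsHolLimit l U f g) {z : E} (hz : z ∈ U) :
    Tendsto (fun i => fderiv ℂ (f i) z) l (𝓝 (fderiv ℂ g z)) :=
  h.tendsto_fderiv.tendsto_at hz

theorem IsHolLimit.tendsto_comp {ι : Type*} {l : Filter ι} {U : Set E} (hU : IsOpen U)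
    {f : ι → E → G} {g : E → G} (h : IsHolLimit l U f g) {u : ι → E} {z : E} (hz : z ∈ U)
    (hu : Tendsto u l (𝓝 z)) : Tendsto (fun i => f i (u i)) l (𝓝 (g z)) := by
  refine h.tendsto.tendsto_comp (h.differentiableOn.continuousOn z hz) hz ?_
  rwa [hU.nhdsWithin_eq hz]

variable [FiniteDimensional ℂ E] [FiniteDimensional ℂ G]

/-- Cauchy estimates make the maps and their derivatives equi-Lipschitz near each point. The
derivatives are bounded, so they converge pointwise along the ultrafilter, hence locally uniformly,
and their limit is the derivative of g. -/
theorem isHolLimit_of_tendsto {ι : Type*} (l : Ultrafilter ι) {U : Set E} (hU : IsOpen U)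
    {f : ι → E → G} {g : E → G} {M : ℝ} (hf : ∀ i, DifferentiableOn ℂ (f i) U)
    (hM : ∀ i, ∀ z ∈ U, ‖f i z‖ ≤ M)
    (hfg : ∀ x ∈ U, Tendsto (fun i => f i x) l (𝓝 (g x))) : IsHolLimit l U f g := by
  have hball : ∀ c ∈ U, ∃ R > 0, ball c R ⊆ U := Metric.isOpen_iff.1 hU
  have hne : Nonempty ι := l.neBot.nonempty
  have hM0 : ∀ c ∈ U, 0 ≤ M := fun c hc => (norm_nonneg _).trans (hM hne.some c hc)
  have h1 : TendstoLocallyUniformlyOn f g l U := by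
    refine tendstoLocallyUniformlyOn_of_lipschitz hU (fun c hc => ?_) hfg
    obtain ⟨R, hR, hRU⟩ := hball c hc
    have := hM0 c hc
    exact ⟨R / 2, by positivity, 4 * M / R, by positivity, fun i x hx y hy =>
      norm_sub_le_of_mem_half_ball hR ((hf i).mono hRU) (fun z hz => hM i z (hRU hz)) hx hy⟩
  have hex : ∀ c, ∃ A : E →L[ℂ] G, c ∈ U → Tendsto (fun i => fderiv ℂ (f i) c) l (𝓝 A) := by
    intro c
    by_cases hc : c ∈ U
    · obtain ⟨R, hR, hRU⟩ := hball c hc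
      obtain ⟨A, hA⟩ := exists_tendsto_ultrafilter_of_norm_le l fun i =>
        norm_fderiv_le_of_norm_le hR ((hf i).mono hRU) (fun z hz => hM i z (hRU hz))
      exact ⟨A, fun _ => hA⟩
    · exact ⟨0, fun h => absurd h hc⟩
  choose A hA using hex
  have h2 : TendstoLocallyUniformlyOn (fun i => fderiv ℂ (f i)) A l U := by
    refine tendstoLocallyUniformlyOn_of_lipschitz hU (fun c hc => ?_) hA
    obtain ⟨R, hR, hRU⟩ := hball c hc
    have := hM0 c hc
    exact ⟨R / 4, by positivity, 32 * M / R ^ 2, by positivity, fun i x hx y hy =>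
      norm_fderiv_sub_le_of_mem_quarter_ball hR ((hf i).mono hRU)
        (fun z hz => hM i z (hRU hz)) hx hy⟩
  have h3 : ∀ z ∈ U, HasFDerivAt g (A z) z := fun z hz =>
    hasFDerivAt_of_tendsto_locally_uniformly_on' hU h2 hf hfg hz
  exact ⟨fun z hz => (h3 z hz).differentiableAt.differentiableWithinAt, h1,
    h2.congr_right fun z hz => (h3 z hz).fderiv.symm⟩

theorem exists_isHolLimit {ι : Type*} (l : Ultrafilter ι) {U : Set E} (hU : IsOpen U)
    {f : ι → E → G} {M : ℝ} (hf : ∀ i, DifferentiableOn ℂ (f i) U)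
    (hM : ∀ i, ∀ z ∈ U, ‖f i z‖ ≤ M) : ∃ g, IsHolLimit l U f g := by
  have hex : ∀ c, ∃ a : G, c ∈ U → Tendsto (fun i => f i c) l (𝓝 a) := by
    intro c
    by_cases hc : c ∈ U
    · obtain ⟨a, ha⟩ := exists_tendsto_ultrafilter_of_norm_le l fun i => hM i c hc
      exact ⟨a, fun _ => ha⟩
    · exact ⟨0, fun h => absurd h hc⟩
  choose g hg using hex
  exact ⟨g, isHolLimit_of_tendsto l hU hf hM hg⟩

/-- The directional derivative is a pointwise limit of difference quotients, which are holomorphic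
and uniformly bounded by the Lipschitz estimate. -/
theorem differentiableAt_fderiv_apply {f : E → G} {U : Set E} (hU : IsOpen U)
    (hf : DifferentiableOn ℂ f U) {c : E} (hc : c ∈ U) (v : E) :
    DifferentiableAt ℂ (fun z => fderiv ℂ f z v) c := by
  obtain ⟨R, hR, hRU⟩ : ∃ R > 0, ∀ z ∈ ball c R, z ∈ U ∧ ‖f z‖ ≤ ‖f c‖ + 1 := by
    have h1 : ∀ᶠ z in 𝓝 c, z ∈ U ∧ ‖f z‖ < ‖f c‖ + 1 :=
      Filter.Eventually.and (hU.mem_nhds hc)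
        ((hf.continuousOn.continuousAt (hU.mem_nhds hc)).norm.eventually_lt_const (lt_add_one _))
    obtain ⟨R, hR, h⟩ := Metric.eventually_nhds_iff_ball.1 h1
    exact ⟨R, hR, fun z hz => ⟨(h z hz).1, (h z hz).2.le⟩⟩
  have hfR : DifferentiableOn ℂ f (ball c R) := hf.mono fun z hz => (hRU z hz).1
  have hd : ∀ z ∈ ball c R, DifferentiableAt ℂ f z := fun z hz =>
    hfR.differentiableAt (isOpen_ball.mem_nhds hz)
  -- Steps short enough to stay in the half ball; `‖v‖ + 1` covers v = 0.
  set t : ℕ → ℂ := fun k => ((R / 4 / (‖v‖ + 1) / (k + 1) : ℝ) : ℂ) with ht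
  have ht0 : ∀ k, t k ≠ 0 := fun k => by
    rw [ht]; simp only [ne_eq, Complex.ofReal_eq_zero]; positivity
  have htv : ∀ k, ‖t k • v‖ < R / 4 := fun k => by
    rw [norm_smul, ht, Complex.norm_real, Real.norm_of_nonneg (by positivity), div_div,
      div_mul_eq_mul_div, div_lt_iff₀ (by positivity)]
    have : ‖v‖ < (‖v‖ + 1) * (k + 1) := by
      have := norm_nonneg v
      have hk : (0 : ℝ) ≤ k := by positivity
      nlinarith
    gcongr
  have hmem : ∀ k, ∀ z ∈ ball c (R / 4), z + t k • v ∈ ball c (R / 2) := fun k z hz => by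
    rw [mem_ball, dist_eq_norm] at hz ⊢
    calc ‖z + t k • v - c‖ = ‖(z - c) + t k • v‖ := by congr 1; abel
      _ ≤ ‖z - c‖ + ‖t k • v‖ := norm_add_le _ _
      _ < R / 2 := by linarith [htv k]
  have hlim : Tendsto t atTop (𝓝 0) := by
    have h0 : Tendsto (fun k : ℕ => R / 4 / (‖v‖ + 1) / ((k : ℝ) + 1)) atTop (𝓝 0) :=
      tendsto_const_nhds.div_atTop (tendsto_natCast_atTop_atTop.atTop_add tendsto_const_nhds)
    exact (Complex.continuous_ofReal.tendsto' 0 0 Complex.ofReal_zero).comp h0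
  have key : IsHolLimit (hyperfilter ℕ : Filter ℕ) (ball c (R / 4))
      (fun k z => (t k)⁻¹ • (f (z + t k • v) - f z)) (fun z => fderiv ℂ f z v) := by
    refine isHolLimit_of_tendsto (M := 4 * (‖f c‖ + 1) / R * ‖v‖) (hyperfilter ℕ) isOpen_ball
      (fun k z hz => ?_) (fun k z hz => ?_) (fun z hz => ?_)
    · refine DifferentiableAt.differentiableWithinAt ?_
      refine DifferentiableAt.const_smul (DifferentiableAt.sub ?_ ?_) _
      · exact (hd _ (ball_subset_ball (by linarith) (hmem k z hz))).comp z
          (f := fun z => z + t k • v) (by fun_prop)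
      · exact hd z (ball_subset_ball (by linarith) hz)
    · have := norm_sub_le_of_mem_half_ball hR hfR (fun z hz => (hRU z hz).2) (hmem k z hz)
        (ball_subset_ball (by linarith) hz)
      rw [add_sub_cancel_left, norm_smul] at this
      rw [norm_smul, norm_inv, inv_mul_le_iff₀ (norm_pos_iff.2 (ht0 k))]
      linarith
    · have h1 := (hd z (ball_subset_ball (by linarith) hz)).hasFDerivAt.hasLineDerivAt v
      have h2 := (hasDerivAt_iff_tendsto_slope_zero.1 h1).comp
        (tendsto_nhdsWithin_iff.2 ⟨hlim, Eventually.of_forall ht0⟩)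
      refine Tendsto.mono_left ?_ (Nat.hyperfilter_le_atTop)
      simpa [Function.comp_def] using h2
  exact key.differentiableOn.differentiableAt (isOpen_ball.mem_nhds (mem_ball_self (by linarith)))

/-- The derivative of a holomorphic map is holomorphic. -/
theorem differentiableAt_fderiv {f : E → G} {U : Set E} (hU : IsOpen U)
    (hf : DifferentiableOn ℂ f U) {c : E} (hc : c ∈ U) :
    DifferentiableAt ℂ (fderiv ℂ f) c := by
  let b := Module.finBasis ℂ E
  have heq : fderiv ℂ f = fun z => ∑ i, ContinuousLinearMap.smulRightL ℂ E G
      (LinearMap.toContinuousLinearMap (b.coord i)) (fderiv ℂ f z (b i)) := by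
    funext z
    ext x
    conv_lhs => rw [← b.sum_repr x]
    simp [-Module.Basis.sum_repr]
  rw [heq]
  refine DifferentiableAt.fun_sum fun i _ => ?_
  exact (ContinuousLinearMap.differentiableAt _).comp c (differentiableAt_fderiv_apply hU hf hc _)

theorem differentiable_clm_det : Differentiable ℂ (fun A : E →L[ℂ] E => A.det) := by
  let b := Module.finBasis ℂ E
  have heq : (fun A : E →L[ℂ] E => A.det) =
      fun A => ∑ σ : Equiv.Perm (Fin (Module.finrank ℂ E)), ((Equiv.Perm.sign σ : ℤ) : ℂ) *
        ∏ i, b.coord (σ i) (A (b i)) := by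
    funext A
    rw [ContinuousLinearMap.det, ← LinearMap.det_toMatrix b, Matrix.det_apply]
    simp [LinearMap.toMatrix_apply, Units.smul_def, zsmul_eq_mul]
  rw [heq]
  refine Differentiable.fun_sum fun σ _ => ?_
  classical
  refine Differentiable.const_mul (fun A => ?_) _
  exact (HasFDerivAt.finsetProd fun i _ => ((b.coord (σ i)).toContinuousLinearMap.comp
    (ContinuousLinearMap.apply ℂ E (b i))).hasFDerivAt).differentiableAt

end Holomorphic

/-! ### Identity theorem -/

section Identity

variable {E G : Type*} [NormedAddCommGroup E] [NormedSpace ℂ E]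
  [NormedAddCommGroup G] [NormedSpace ℂ G] [CompleteSpace G]

/-- On the complex line through u and z this is the one-variable identity theorem; the ball cuts out
a convex set of parameters. -/
theorem eq_zero_of_eventuallyEq_zero_of_mem_ball {f : E → G} {c u z : E} {r : ℝ}
    (hf : DifferentiableOn ℂ f (ball c r)) (hu : u ∈ ball c r) (hz : z ∈ ball c r)
    (h0 : f =ᶠ[𝓝 u] 0) : f z = 0 := by
  let : NormedSpace ℝ E := NormedSpace.restrictScalars ℝ ℂ E
  let γ : ℂ → E := fun t => u + t • (z - u)
  have hγ : Differentiable ℂ γ := by simp only [γ]; fun_prop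
  have hγ0 : γ 0 = u := by simp [γ]
  have hγ1 : γ 1 = z := by simp [γ]
  have hSo : IsOpen (γ ⁻¹' ball c r) := isOpen_ball.preimage hγ.continuous
  have hSc : Convex ℝ (γ ⁻¹' ball c r) := by
    intro x hx y hy a b ha hb hab
    have : γ (a • x + b • y) = a • γ x + b • γ y := by
      have h1 : u = a • u + b • u := by rw [← add_smul, hab, one_smul]
      simp only [γ, add_smul, smul_add, smul_assoc]
      rw [add_add_add_comm, ← h1]
    rw [mem_preimage, this]
    exact convex_ball c r hx hy ha hb hab
  have han : AnalyticOnNhd ℂ (f ∘ γ) (γ ⁻¹' ball c r) :=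
    (hf.comp hγ.differentiableOn (mapsTo_preimage _ _)).analyticOnNhd hSo
  have h0' : f ∘ γ =ᶠ[𝓝 0] 0 := by
    have : Tendsto γ (𝓝 0) (𝓝 u) := by simpa [hγ0] using hγ.continuous.tendsto 0
    exact this.eventually h0
  have := han.eqOn_zero_of_preconnected_of_eventuallyEq_zero hSc.isPreconnected
    (by simpa [hγ0] using hu) h0' (x := 1) (by simpa [hγ1] using hz)
  simpa [hγ1] using this

/-- The identity theorem in several variables. -/
theorem eqOn_zero_of_eventuallyEq_zero {f : E → G} {U : Set E} (hU : IsOpen U)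
    (hUc : IsPreconnected U) (hf : DifferentiableOn ℂ f U) {c : E} (hc : c ∈ U)
    (h0 : f =ᶠ[𝓝 c] 0) : ∀ z ∈ U, f z = 0 := by
  have key : U ⊆ {z | f =ᶠ[𝓝 z] 0} := by
    refine hUc.subset_of_closure_inter_subset (isOpen_setOfPred_eventually_nhds) ⟨c, hc, h0⟩ ?_
    rintro z ⟨hz, hzU⟩
    obtain ⟨r, hr, hrU⟩ := Metric.isOpen_iff.1 hU z hzU
    obtain ⟨u, hu, hzu⟩ := Metric.mem_closure_iff.1 hz r hr
    filter_upwards [ball_mem_nhds z hr] with w hw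
    exact eq_zero_of_eventuallyEq_zero_of_mem_ball (hf.mono hrU) (mem_ball'.2 hzu) hw hu
  exact fun z hz => (key hz).self_of_nhds

end Identity

/-! ### Hurwitz's theorem -/

section Hurwitz

variable {ι : Type*}

/-- Zeros of g are isolated, so |g| has a positive minimum on a small circle. The maximum principle
for 1 / d i bounds |d i 0| below by half of it, and the bound survives the limit. -/
theorem apply_zero_ne_zero_of_isHolLimit {l : Filter ι} [l.NeBot] {d : ι → ℂ → ℂ} {g : ℂ → ℂ}
    {R : ℝ} (hd : ∀ i, DifferentiableOn ℂ (d i) (ball 0 R)) (hlim : IsHolLimit l (ball 0 R) d g)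
    (hnz : ∀ᶠ i in l, ∀ z ∈ ball 0 R, d i z ≠ 0) {u : ℂ} (hu : u ∈ ball 0 R) (hgu : g u ≠ 0) :
    g 0 ≠ 0 := by
  have hR : 0 < R := (norm_nonneg u).trans_lt (by simpa using hu)
  have hg := hlim.differentiableOn
  have han : AnalyticAt ℂ g 0 := hg.analyticAt (ball_mem_nhds 0 hR)
  have hne : ∀ᶠ z in 𝓝[≠] (0 : ℂ), g z ≠ 0 := by
    rcases han.eventually_eq_zero_or_eventually_ne_zero with h | h
    · exact absurd (eq_zero_of_eventuallyEq_zero_of_mem_ball hg (mem_ball_self hR) hu h) hgu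
    · exact h
  obtain ⟨ρ', hρ', hρne⟩ := Metric.eventually_nhds_iff_ball.1 (eventually_nhdsWithin_iff.1 hne)
  set ρ := min ρ' R / 2 with hρdef
  have hρ : 0 < ρ := by positivity
  have hρ1 : ρ < ρ' := by linarith [min_le_left ρ' R, lt_min hρ' hR]
  have hρ2 : ρ < R := by linarith [min_le_right ρ' R, lt_min hρ' hR]
  have hsub : sphere (0 : ℂ) ρ ⊆ ball 0 R := fun z hz => by
    rw [mem_sphere] at hz; rw [mem_ball]; linarith
  obtain ⟨w, hw, hwmin⟩ := (isCompact_sphere (0 : ℂ) ρ).exists_isMinOn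
    (NormedSpace.sphere_nonempty.2 hρ.le) (hg.continuousOn.mono hsub).norm
  have hc : 0 < ‖g w‖ := by
    rw [mem_sphere] at hw
    refine norm_pos_iff.2 (hρne w (by rw [mem_ball]; linarith) ?_)
    rintro (rfl : w = 0)
    simp at hw
    linarith
  have hunif : TendstoUniformlyOn d g l (sphere 0 ρ) :=
    (tendstoLocallyUniformlyOn_iff_tendstoUniformlyOn_of_compact (isCompact_sphere _ _)).1
      (hlim.tendsto.mono hsub)
  have hlow : ∀ᶠ i in l, ‖g w‖ / 2 ≤ ‖d i 0‖ := by
    filter_upwards [hnz, Metric.tendstoUniformlyOn_iff.1 hunif (‖g w‖ / 2) (by positivity)]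
      with i hi1 hi2
    have hdiff : DiffContOnCl ℂ (fun z => (d i z)⁻¹) (ball 0 ρ) := by
      refine DifferentiableOn.diffContOnCl ?_
      rw [closure_ball _ hρ.ne']
      have hcb : closedBall (0 : ℂ) ρ ⊆ ball 0 R := closedBall_subset_ball hρ2
      exact ((hd i).mono hcb).fun_inv fun z hz => hi1 z (hcb hz)
    have hb : ∀ z ∈ frontier (ball (0 : ℂ) ρ), ‖(d i z)⁻¹‖ ≤ (‖g w‖ / 2)⁻¹ := by
      intro z hz
      rw [frontier_ball _ hρ.ne'] at hz
      rw [norm_inv]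
      refine inv_anti₀ (by positivity) ?_
      have h1 := hi2 z hz
      have h2 : ‖g w‖ ≤ ‖g z‖ := hwmin hz
      rw [dist_eq_norm] at h1
      have h3 := norm_sub_norm_le (g z) (d i z)
      linarith
    have := Complex.norm_le_of_forall_mem_frontier_norm_le isBounded_ball hdiff hb
      (z := 0) (subset_closure (mem_ball_self hρ))
    rw [norm_inv] at this
    exact (inv_le_inv₀ (norm_pos_iff.2 (hi1 0 (mem_ball_self hR))) (by positivity)).1 this
  have := ge_of_tendsto (hlim.tendsto_at (mem_ball_self hR)).norm hlow
  exact norm_pos_iff.1 (by linarith)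

/-- Hurwitz's theorem: a limit of nonvanishing holomorphic functions of several variables on a ball
that is not identically zero does not vanish at the centre. -/
theorem apply_center_ne_zero_of_tendsto {E : Type*} [NormedAddCommGroup E] [NormedSpace ℂ E]
    (l : Ultrafilter ι) {d : ι → E → ℂ} {g : E → ℂ} {c : E} {R M : ℝ}
    (hd : ∀ i, DifferentiableOn ℂ (d i) (ball c R)) (hM : ∀ i, ∀ z ∈ ball c R, ‖d i z‖ ≤ M)
    (hdg : ∀ z ∈ ball c R, Tendsto (fun i => d i z) l (𝓝 (g z)))
    (hnz : ∀ᶠ i in l, ∀ z ∈ ball c R, d i z ≠ 0) {u : E} (hu : u ∈ ball c R) (hgu : g u ≠ 0) :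
    g c ≠ 0 := by
  by_cases huc : u = c
  · exact huc ▸ hgu
  have hpos : 0 < ‖u - c‖ := norm_pos_iff.2 (sub_ne_zero.2 huc)
  have hR : ‖u - c‖ < R := by rwa [mem_ball, dist_eq_norm] at hu
  -- The complex line through c and u, with u at parameter 1, reduces to one variable.
  let γ : ℂ → E := fun t => c + t • (u - c)
  have hγ : MapsTo γ (ball 0 (R / ‖u - c‖)) (ball c R) := fun t ht => by
    rw [mem_ball_zero_iff, lt_div_iff₀ hpos] at ht
    simpa [γ, mem_ball, dist_eq_norm, norm_smul] using ht
  have hγd : Differentiable ℂ γ := by simp only [γ]; fun_prop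
  have hd' : ∀ i, DifferentiableOn ℂ (d i ∘ γ) (ball 0 (R / ‖u - c‖)) := fun i =>
    (hd i).comp hγd.differentiableOn hγ
  have hlim : IsHolLimit (l : Filter ι) (ball 0 (R / ‖u - c‖)) (fun i => d i ∘ γ) (g ∘ γ) :=
    isHolLimit_of_tendsto l isOpen_ball hd' (fun i z hz => hM i _ (hγ hz))
      (fun z hz => hdg _ (hγ hz))
  have := apply_zero_ne_zero_of_isHolLimit hd' hlim (hnz.mono fun i hi z hz => hi _ (hγ hz))
    (u := 1) (by simpa [lt_div_iff₀ hpos] using hR) (by simpa [γ] using hgu)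
  simpa [γ] using this

end Hurwitz

/-! ### Cartan's uniqueness theorem, asymptotically -/

section Cartan

variable {E : Type*} [NormedAddCommGroup E] [NormedSpace ℂ E] [FiniteDimensional ℂ E]

/-- A holomorphic map whose derivative at `P` is the identity is injective near `P`. -/
theorem eventually_injective_of_fderiv_eq_one {T : E → E} {U : Set E} (hU : IsOpen U)
    (hT : DifferentiableOn ℂ T U) {P : E} (hP : P ∈ U) (h1 : fderiv ℂ T P = 1) :
    ∀ᶠ p : E × E in 𝓝 (P, P), T p.1 = T p.2 → p.1 = p.2 := by
  have hs : HasStrictFDerivAt T (1 : E →L[ℂ] E) P := by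
    refine hasStrictFDerivAt_of_hasFDerivAt_of_continuousAt (f' := fderiv ℂ T)
      (eventually_of_mem (hU.mem_nhds hP) fun z hz =>
        (hT.differentiableAt (hU.mem_nhds hz)).hasFDerivAt)
      (differentiableAt_fderiv hU hT hP).continuousAt |>.congr_fderiv h1
  filter_upwards [hs.isLittleO.bound (show (0 : ℝ) < 1 / 2 by norm_num)] with p hp heq
  rw [heq] at hp
  simp only [sub_self, one_apply_eq_self, zero_sub, norm_neg] at hp
  have : ‖p.1 - p.2‖ ≤ 0 := by linarith
  exact sub_eq_zero.1 (norm_le_zero_iff.1 this)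

/-- Asymptotic form of Cartan's uniqueness theorem: self-maps of a bounded domain with a fixed point
whose derivatives there tend to the identity converge to the identity. -/
theorem tendsto_self_of_tendsto_fderiv_one {ι : Type*} (l : Ultrafilter ι) {Ω : Set E} {M : ℝ}
    (hΩ : IsOpen Ω) (hΩc : IsPreconnected Ω) (hM : ∀ z ∈ Ω, ‖z‖ ≤ M) {P : E} (hP : P ∈ Ω)
    {h : ι → E → E} (hd : ∀ i, DifferentiableOn ℂ (h i) Ω) (hmaps : ∀ i, MapsTo (h i) Ω Ω)
    (hfix : ∀ i, h i P = P) (hone : Tendsto (fun i => fderiv ℂ (h i) P) l (𝓝 1)) :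
    ∀ z ∈ Ω, Tendsto (fun i => h i z) l (𝓝 z) := by
  have hM0 : 0 ≤ M := (norm_nonneg P).trans (hM P hP)
  obtain ⟨g, hg⟩ := exists_isHolLimit l hΩ hd (fun i z hz => hM _ (hmaps i hz))
  have hgP : g P = P := tendsto_nhds_unique (hg.tendsto_at hP) (by simp [hfix])
  have hiter : ∀ i k, MapsTo (h i)^[k] Ω Ω := fun i k => (hmaps i).iterate k
  have hditer : ∀ i k, DifferentiableOn ℂ (h i)^[k] Ω := fun i k => by
    induction k with
    | zero => exact differentiableOn_id
    | succ k ih => exact ih.comp (hd i) (hmaps i)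
  have hfd : ∀ i k, HasFDerivAt (h i)^[k] (fderiv ℂ (h i) P ^ k) P := fun i k =>
    ((hd i).differentiableAt (hΩ.mem_nhds hP)).hasFDerivAt.iterate (hfix i) k
  -- Cesàro means of the iterates: almost h-invariant, since T ∘ h - T telescopes, and with
  -- derivative at P tending to 1 along `l` for fixed m. Their values may leave Ω but stay bounded
  -- by M.
  let T : ℕ → ι → E → E := fun m i z => ((m : ℂ) + 1)⁻¹ • ∑ k ∈ Finset.range (m + 1), (h i)^[k] z
  have hm0 : ∀ m : ℕ, ((m : ℂ) + 1) ≠ 0 := fun m => Nat.cast_add_one_ne_zero m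
  have hmn : ∀ m : ℕ, ‖((m : ℂ) + 1)⁻¹‖ = ((m : ℝ) + 1)⁻¹ := fun m => by
    rw [norm_inv]; congr 1; exact_mod_cast Complex.norm_natCast (m + 1)
  have hTd : ∀ m i, DifferentiableOn ℂ (T m i) Ω := fun m i =>
    (DifferentiableOn.fun_sum fun k _ => hditer i k).const_smul _
  have hTM : ∀ m i, ∀ z ∈ Ω, ‖T m i z‖ ≤ M := fun m i z hz => by
    simp only [T]
    rw [norm_smul, hmn, inv_mul_le_iff₀ (by positivity)]
    refine (norm_sum_le_of_le _ fun k _ => hM _ (hiter i k hz)).trans_eq ?_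
    simp
  have hTP : ∀ m i, fderiv ℂ (T m i) P =
      ((m : ℂ) + 1)⁻¹ • ∑ k ∈ Finset.range (m + 1), fderiv ℂ (h i) P ^ k := fun m i =>
    ((HasFDerivAt.fun_sum fun k _ => hfd i k).const_smul _).fderiv
  have hTcomp : ∀ m i, ∀ z ∈ Ω, ‖T m i (h i z) - T m i z‖ ≤ 2 * M / (m + 1) := by
    intro m i z hz
    have : T m i (h i z) - T m i z = ((m : ℂ) + 1)⁻¹ • ((h i)^[m + 1] z - z) := by
      simp only [T]
      rw [← smul_sub, ← Finset.sum_sub_distrib]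
      congr 1
      simp only [← Function.iterate_succ_apply]
      rw [Finset.sum_range_sub (fun k => (h i)^[k] z)]
      rfl
    rw [this, norm_smul, hmn, inv_mul_le_iff₀ (by positivity)]
    have h1 := norm_sub_le ((h i)^[m + 1] z) z
    have h2 := hM _ (hiter i (m + 1) hz)
    have h3 := hM z hz
    rw [mul_div_cancel₀ _ (by positivity)]
    linarith
  choose S hS using fun m => exists_isHolLimit l hΩ (hTd m) (hTM m)
  have hSM : ∀ m, ∀ z ∈ Ω, ‖S m z‖ ≤ M := fun m z hz =>
    le_of_tendsto ((hS m).tendsto_at hz).norm (Eventually.of_forall fun i => hTM m i z hz)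
  have hSP : ∀ m, fderiv ℂ (S m) P = 1 := fun m => by
    refine tendsto_nhds_unique ((hS m).tendsto_fderiv_at hP) ?_
    simp only [hTP]
    have h1 : Tendsto (fun i => ((m : ℂ) + 1)⁻¹ • ∑ k ∈ Finset.range (m + 1), fderiv ℂ (h i) P ^ k)
        l (𝓝 (((m : ℂ) + 1)⁻¹ • ∑ k ∈ Finset.range (m + 1), (1 : E →L[ℂ] E) ^ k)) :=
      (tendsto_finsetSum _ fun k _ => hone.pow k).const_smul _
    convert h1
    have : (((m : ℂ) + 1) • (1 : E →L[ℂ] E)) = ((m : E →L[ℂ] E) + 1) := by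
      rw [add_smul, one_smul]
      congr 1
      ext x
      simp [Nat.cast_smul_eq_nsmul]
    simp only [one_pow, Finset.sum_const, Finset.card_range, nsmul_eq_mul, mul_one, Nat.cast_add,
      Nat.cast_one]
    rw [← this, inv_smul_smul₀ (hm0 m)]
  -- The limit g may reach the boundary of Ω, hence the hypothesis on g z; it holds near P because g
  -- P = P.
  have hScomp : ∀ m, ∀ z ∈ Ω, g z ∈ Ω → ‖S m (g z) - S m z‖ ≤ 2 * M / (m + 1) :=
    fun m z hz hgz => le_of_tendsto
      (((hS m).tendsto_comp hΩ hgz (hg.tendsto_at hz)).sub ((hS m).tendsto_at hz)).norm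
      (Eventually.of_forall fun i => hTcomp m i z hz)
  -- Letting m → ∞ gives L ∘ g = L near P with L'(P) = 1. Local injectivity of L then yields g = id
  -- there.
  obtain ⟨L, hL⟩ := exists_isHolLimit (hyperfilter ℕ) hΩ (fun m => (hS m).differentiableOn) hSM
  have hLP : fderiv ℂ L P = 1 :=
    tendsto_nhds_unique (hL.tendsto_fderiv_at hP) (by simp [hSP])
  have hLcomp : ∀ z ∈ Ω, g z ∈ Ω → L (g z) = L z := fun z hz hgz => by
    have h1 := ((hL.tendsto_at hgz).sub (hL.tendsto_at hz)).norm
    have h2 : Tendsto (fun m : ℕ => 2 * M / ((m : ℝ) + 1)) (hyperfilter ℕ : Filter ℕ) (𝓝 0) :=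
      (tendsto_const_nhds.div_atTop
        (tendsto_natCast_atTop_atTop.atTop_add tendsto_const_nhds)).mono_left
        Nat.hyperfilter_le_atTop
    have h3 := le_of_tendsto_of_tendsto h1 h2 (Eventually.of_forall fun m => hScomp m z hz hgz)
    exact sub_eq_zero.1 (norm_le_zero_iff.1 h3)
  have hgcont : ContinuousAt g P := hg.differentiableOn.continuousOn.continuousAt (hΩ.mem_nhds hP)
  have hnear : (fun z => g z - z) =ᶠ[𝓝 P] 0 := by
    have h1 : Tendsto (fun z => (g z, z)) (𝓝 P) (𝓝 (P, P)) := by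
      have h2 := hgcont.tendsto
      rw [hgP] at h2
      exact h2.prodMk_nhds tendsto_id
    have h3 : ∀ᶠ z in 𝓝 P, g z ∈ Ω := hgcont.eventually (by rw [hgP]; exact hΩ.mem_nhds hP)
    filter_upwards [h1.eventually (eventually_injective_of_fderiv_eq_one hΩ hL.differentiableOn hP
      hLP), h3, hΩ.mem_nhds hP] with z hz hgz hzΩ
    exact sub_eq_zero.2 (hz (hLcomp z hzΩ hgz))
  intro z hz
  have hall := eqOn_zero_of_eventuallyEq_zero hΩ hΩc
    (hg.differentiableOn.sub differentiableOn_id) hP hnear z hz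
  have := hg.tendsto_at hz
  rwa [sub_eq_zero.1 hall] at this

end Cartan

/-! ### Determinants and power-bounded operators -/

section LinearAlgebra

variable {E : Type*} [NormedAddCommGroup E] [NormedSpace ℂ E]

theorem clm_det_mul (A B : E →L[ℂ] E) : (A * B).det = A.det * B.det :=
  LinearMap.det_comp (A : E →ₗ[ℂ] E) (B : E →ₗ[ℂ] E)

theorem clm_det_one : (1 : E →L[ℂ] E).det = 1 :=
  LinearMap.det_id

theorem clm_det_pow (A : E →L[ℂ] E) (k : ℕ) : (A ^ k).det = A.det ^ k := by
  induction k with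
  | zero => simpa using clm_det_one
  | succ k ih => rw [pow_succ, clm_det_mul, ih, pow_succ]

theorem clm_det_ne_zero_of_isUnit {A : E →L[ℂ] E} (hA : IsUnit A) : A.det ≠ 0 := by
  obtain ⟨B, hB⟩ := hA.exists_right_inv
  intro h
  have := congrArg ContinuousLinearMap.det hB
  rw [clm_det_mul, h, zero_mul, clm_det_one] at this
  exact zero_ne_one this

variable [FiniteDimensional ℂ E]

theorem isUnit_clm_of_det_ne_zero {A : E →L[ℂ] E} (hA : A.det ≠ 0) : IsUnit A :=
  ⟨ContinuousLinearEquiv.toUnit (A.toContinuousLinearEquivOfDetNeZero hA), by ext; rfl⟩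

/-- A power-bounded operator whose determinant has modulus at least one has positive powers
arbitrarily close to the identity. -/
theorem exists_pow_succ_sub_one_norm_lt {A : E →L[ℂ] E} {M : ℝ} (hA : ∀ k : ℕ, ‖A ^ k‖ ≤ M)
    (hdet : 1 ≤ ‖A.det‖) {ε : ℝ} (hε : 0 < ε) : ∃ k : ℕ, ‖A ^ (k + 1) - 1‖ < ε := by
  have : ProperSpace (E →L[ℂ] E) := FiniteDimensional.proper ℂ _
  have : CompleteSpace E := FiniteDimensional.complete ℂ E
  obtain ⟨B, -, φ, hφ, hB⟩ := (isCompact_closedBall (0 : E →L[ℂ] E) M).tendsto_subseq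
    (x := fun k => A ^ k) (fun k => by simpa using hA k)
  have hunit : ∀ k, IsUnit (A ^ k) := fun k =>
    (isUnit_clm_of_det_ne_zero (norm_pos_iff.1 (by linarith))).pow k
  have hBdet : 1 ≤ ‖B.det‖ := by
    refine ge_of_tendsto
      ((differentiable_clm_det.continuous.norm.tendsto B).comp hB) (Eventually.of_forall fun k => ?_)
    simpa [clm_det_pow] using one_le_pow₀ hdet
  obtain ⟨b, rfl⟩ : IsUnit B := isUnit_clm_of_det_ne_zero (norm_pos_iff.1 (by linarith))
  have hinv : Tendsto (fun n => Ring.inverse (A ^ φ n)) atTop (𝓝 (Ring.inverse (b : E →L[ℂ] E))) :=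
    (NormedRing.inverse_continuousAt b).tendsto.comp hB
  -- Quotients of consecutive terms of the convergent subsequence tend to B B⁻¹ = 1, and they are
  -- positive powers of A because φ is strictly increasing.
  have hlim : Tendsto (fun n => A ^ φ (n + 1) * Ring.inverse (A ^ φ n)) atTop (𝓝 1) := by
    have := (hB.comp (tendsto_add_atTop_nat 1)).mul hinv
    rwa [Ring.mul_inverse_cancel _ b.isUnit] at this
  obtain ⟨n, hn⟩ := (Metric.tendsto_nhds.1 hlim ε hε).exists
  obtain ⟨k, hk⟩ := Nat.exists_eq_add_of_lt (hφ (Nat.lt_succ_self n))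
  refine ⟨k, ?_⟩
  rw [dist_eq_norm] at hn
  rwa [show φ (n + 1) = (k + 1) + φ n by rw [hk]; ring, pow_add, mul_assoc,
    Ring.mul_inverse_cancel _ (hunit _), mul_one] at hn

end LinearAlgebra

/-! ### Almost extremal maps and their limits -/

section HolMaps

variable {n : ℕ} {U V W : Set (Cn n)} {P Q R : Cn n}

theorem comp_mem_HolMaps {φ ψ : Cn n → Cn n} (hψ : ψ ∈ HolMaps V W Q R)
    (hφ : φ ∈ HolMaps U V P Q) : ψ ∘ φ ∈ HolMaps U W P R :=
  ⟨hψ.1.comp hφ.1 hφ.2.1, hψ.2.1.comp hφ.2.1, by rw [Function.comp_apply, hφ.2.2, hψ.2.2]⟩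

theorem iterate_mem_HolMaps {g : Cn n → Cn n} (hg : g ∈ HolMaps U U P P) (k : ℕ) :
    g^[k] ∈ HolMaps U U P P := by
  induction k with
  | zero => exact ⟨differentiableOn_id, mapsTo_id U, rfl⟩
  | succ k ih => exact comp_mem_HolMaps ih hg

theorem fderiv_comp_of_mapsTo {φ ψ : Cn n → Cn n} (hU : IsOpen U) (hV : IsOpen V)
    (hψ : DifferentiableOn ℂ ψ V) (hφ : DifferentiableOn ℂ φ U) (hm : MapsTo φ U V)
    {z : Cn n} (hz : z ∈ U) :
    fderiv ℂ (ψ ∘ φ) z = fderiv ℂ ψ (φ z) * fderiv ℂ φ z :=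
  fderiv_comp z (hψ.differentiableAt (hV.mem_nhds (hm hz))) (hφ.differentiableAt (hU.mem_nhds hz))

theorem fderiv_comp_HolMaps {φ ψ : Cn n → Cn n} (hU : IsOpen U) (hV : IsOpen V)
    (hψ : ψ ∈ HolMaps V W Q R) (hφ : φ ∈ HolMaps U V P Q) (hP : P ∈ U) :
    fderiv ℂ (ψ ∘ φ) P = fderiv ℂ ψ Q * fderiv ℂ φ P := by
  rw [fderiv_comp_of_mapsTo hU hV hψ.1 hφ.1 hφ.2.1 hP, hφ.2.2]

theorem fderiv_iterate_HolMaps {g : Cn n → Cn n} (hU : IsOpen U) (hP : P ∈ U)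
    (hg : g ∈ HolMaps U U P P) (k : ℕ) : fderiv ℂ g^[k] P = fderiv ℂ g P ^ k :=
  ((hg.1.differentiableAt (hU.mem_nhds hP)).hasFDerivAt.iterate hg.2.2 k).fderiv

theorem IsBoundedDomain.exists_norm_le (hU : IsBoundedDomain U) : ∃ M, ∀ z ∈ U, ‖z‖ ≤ M :=
  hU.isBounded.exists_norm_le

/-- If the Jacobians of maps `U → V → U` fixing `P` can be made almost unimodular, then
the derivatives of such maps can be made arbitrarily close to the identity. -/
theorem exists_HolMaps_fderiv_near_one (hU : IsBoundedDomain U) (hV : IsOpen V) (hP : P ∈ U)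
    (hdet : ∀ s : ℝ, 0 < s → s < 1 → ∃ φ ∈ HolMaps U V P Q, ∃ ψ ∈ HolMaps V U Q P,
      s ≤ ‖(fderiv ℂ ψ Q * fderiv ℂ φ P).det‖) {ε : ℝ} (hε : 0 < ε) :
    ∃ φ ∈ HolMaps U V P Q, ∃ ψ ∈ HolMaps V U Q P, ‖fderiv ℂ ψ Q * fderiv ℂ φ P - 1‖ < ε := by
  obtain ⟨M, hM⟩ := hU.exists_norm_le
  obtain ⟨r, hr, hrU⟩ := Metric.isOpen_iff.1 hU.isOpen P hP
  let s : ℕ → ℝ := fun j => 1 - 1 / ((j : ℝ) + 1 + 1)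
  have hs : ∀ j, 0 < s j ∧ s j < 1 := fun j => by
    have h1 : 0 < 1 / ((j : ℝ) + 1 + 1) := by positivity
    have h2 : 1 / ((j : ℝ) + 1 + 1) < 1 := by
      rw [div_lt_one (by positivity)]
      linarith [(Nat.cast_nonneg j : (0 : ℝ) ≤ j)]
    exact ⟨by simp only [s]; linarith, by simp only [s]; linarith⟩
  have hslim : Tendsto s (hyperfilter ℕ : Filter ℕ) (𝓝 1) := by
    have h1 : Tendsto (fun j : ℕ => 1 / ((j : ℝ) + 1 + 1)) atTop (𝓝 0) :=
      tendsto_const_nhds.div_atTop ((tendsto_natCast_atTop_atTop.atTop_add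
        tendsto_const_nhds).atTop_add tendsto_const_nhds)
    have h2 := (tendsto_const_nhds (x := (1 : ℝ))).sub h1
    rw [sub_zero] at h2
    exact h2.mono_left Nat.hyperfilter_le_atTop
  choose φ hφ ψ hψ hj using fun j => hdet (s j) (hs j).1 (hs j).2
  have hg : ∀ j, ψ j ∘ φ j ∈ HolMaps U U P P := fun j => comp_mem_HolMaps (hψ j) (hφ j)
  have hgd : ∀ j, fderiv ℂ (ψ j ∘ φ j) P = fderiv ℂ (ψ j) Q * fderiv ℂ (φ j) P := fun j =>
    fderiv_comp_HolMaps hU.isOpen hV (hψ j) (hφ j) hP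
  have hpow : ∀ j k, ‖fderiv ℂ (ψ j ∘ φ j) P ^ k‖ ≤ 2 * M / r := fun j k => by
    have hk := iterate_mem_HolMaps (hg j) k
    rw [← fderiv_iterate_HolMaps hU.isOpen hP (hg j)]
    exact norm_fderiv_le_of_norm_le hr (hk.1.mono hrU) fun z hz => hM _ (hk.2.1 (hrU hz))
  obtain ⟨A, hA⟩ := exists_tendsto_ultrafilter_of_norm_le (hyperfilter ℕ)
    (u := fun j => fderiv ℂ (ψ j ∘ φ j) P) fun j => by simpa using hpow j 1
  have hApow : ∀ k, ‖A ^ k‖ ≤ 2 * M / r := fun k =>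
    le_of_tendsto (hA.pow k).norm (Eventually.of_forall fun j => hpow j k)
  have hAdet : 1 ≤ ‖A.det‖ :=
    le_of_tendsto_of_tendsto hslim ((differentiable_clm_det.continuous.norm.tendsto A).comp hA)
      (Eventually.of_forall fun j => by simpa [hgd] using hj j)
  obtain ⟨k, hk⟩ := exists_pow_succ_sub_one_norm_lt hApow hAdet hε
  obtain ⟨j, hjk⟩ :=
    (((hA.pow (k + 1)).sub_const 1).norm.eventually_lt_const hk).exists
  -- Composing with ψ j gives the (k + 1)-st iterate; a positive exponent leaves one φ j to land in
  -- V.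
  refine ⟨φ j ∘ (ψ j ∘ φ j)^[k], comp_mem_HolMaps (hφ j) (iterate_mem_HolMaps (hg j) k),
    ψ j, hψ j, ?_⟩
  rwa [fderiv_comp_HolMaps hU.isOpen hU.isOpen (hφ j) (iterate_mem_HolMaps (hg j) k) hP,
    fderiv_iterate_HolMaps hU.isOpen hP (hg j), ← mul_assoc, ← hgd, ← pow_succ']

/-- If `F i → f` with `f'(z₀)` invertible, then `f z₀` is eventually attained by `F i` near `z₀`. -/
theorem eventually_mem_image_of_isHolLimit {l : Filter ℕ} (hU : IsOpen U)
    {F : ℕ → Cn n → Cn n} {f : Cn n → Cn n} (hF : ∀ i, DifferentiableOn ℂ (F i) U)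
    (hf : IsHolLimit l U F f) {z₀ : Cn n} (hz₀ : z₀ ∈ U) (hdet : (fderiv ℂ f z₀).det ≠ 0) :
    ∀ᶠ i in l, f z₀ ∈ F i '' U := by
  let e := (fderiv ℂ f z₀).toContinuousLinearEquivOfDetNeZero hdet
  have he : (e : Cn n →L[ℂ] Cn n) = fderiv ℂ f z₀ := by ext; rfl
  let N : NNReal := ‖(e.symm : Cn n →L[ℂ] Cn n)‖₊ + 1
  have hN : 0 < N := by positivity
  let inv : (e : Cn n →L[ℂ] Cn n).NonlinearRightInverse :=
    { toFun := e.symm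
      nnnorm := N
      bound' := fun y => by
        refine ((e.symm : Cn n →L[ℂ] Cn n).le_opNorm y).trans ?_
        gcongr
        simp [N]
      right_inv' := fun y => e.apply_symm_apply y }
  -- Being below N⁻¹, this error keeps F i quantitatively open near z₀. Half of it pays for F i' -
  -- f', half for the variation of f'.
  let c : NNReal := N⁻¹ / 2
  have hc : (0 : ℝ) < c := by simp only [c]; positivity
  obtain ⟨t, ht, hti⟩ := Metric.tendstoLocallyUniformlyOn_iff.1 hf.tendsto_fderiv (c / 2)
    (by positivity) z₀ hz₀
  rw [hU.nhdsWithin_eq hz₀] at ht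
  have hcont : ∀ᶠ z in 𝓝 z₀, dist (fderiv ℂ f z) (fderiv ℂ f z₀) < c / 2 :=
    Metric.tendsto_nhds.1 (differentiableAt_fderiv hU hf.differentiableOn hz₀).continuousAt _
      (by positivity)
  obtain ⟨δ, hδ, hball⟩ := Metric.eventually_nhds_iff_ball.1
    ((Filter.Eventually.and ht hcont).and (hU.mem_nhds hz₀))
  have hrad : (0 : ℝ) < ((inv.nnnorm : ℝ)⁻¹ - c) * (δ / 2) := by
    refine mul_pos ?_ (by positivity)
    have h1 : (0 : ℝ) < (N : ℝ)⁻¹ := by positivity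
    simp only [inv, c, NNReal.coe_div, NNReal.coe_inv, NNReal.coe_ofNat]
    linarith
  filter_upwards [hti, Metric.tendsto_nhds.1 (hf.tendsto_at hz₀) _ hrad] with i hi hclose
  have happ : ApproximatesLinearOn (F i) (e : Cn n →L[ℂ] Cn n) (ball z₀ δ) c := by
    let : NormedSpace ℝ (Cn n) := NormedSpace.restrictScalars ℝ ℂ (Cn n)
    intro x hx y hy
    refine (convex_ball z₀ δ).norm_image_sub_le_of_norm_hasFDerivWithin_le' (𝕜 := ℂ)
      (f' := fderiv ℂ (F i)) (fun z hz => ?_) (fun z hz => ?_) hy hx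
    · exact ((hF i).differentiableAt (hU.mem_nhds (hball z hz).2)).hasFDerivAt.hasFDerivWithinAt
    · have h1 := hi z (hball z hz).1.1
      have h2 := (hball z hz).1.2
      rw [he, ← dist_eq_norm]
      linarith [dist_triangle_left (fderiv ℂ (F i) z) (fderiv ℂ f z₀) (fderiv ℂ f z)]
  obtain ⟨w, hw, hwf⟩ := happ.surjOn_closedBall_of_nonlinearRightInverse inv (b := z₀)
    (half_pos hδ).le (closedBall_subset_ball (half_lt_self hδ))
    (mem_closedBall'.2 hclose.le)
  exact ⟨w, (hball w (closedBall_subset_ball (half_lt_self hδ) hw)).2, hwf⟩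

/-- A priori f only reaches the closure of V. Since (Ψ i ∘ F i)' → 1, the Jacobians of F i
eventually do not vanish near z₀, so by Hurwitz neither does that of f at z₀. Then f z₀ is a value
of some F i, hence lies in V. -/
theorem mapsTo_of_isHolLimit (l : Ultrafilter ℕ) (hU : IsBoundedDomain U) (hV : IsBoundedDomain V)
    (hP : P ∈ U) {F Ψ : ℕ → Cn n → Cn n} (hF : ∀ i, F i ∈ HolMaps U V P Q)
    (hΨ : ∀ i, Ψ i ∈ HolMaps V U Q P)
    (hid : ∀ z ∈ U, Tendsto (fun i => Ψ i (F i z)) l (𝓝 z))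
    {f : Cn n → Cn n} (hf : IsHolLimit l U F f) (hdet : (fderiv ℂ f P).det ≠ 0) :
    MapsTo f U V := by
  obtain ⟨M, hM⟩ := hU.exists_norm_le
  obtain ⟨M', hM'⟩ := hV.exists_norm_le
  intro z₀ hz₀
  have hcomp : IsHolLimit (l : Filter ℕ) U (fun i => Ψ i ∘ F i) id :=
    isHolLimit_of_tendsto l hU.isOpen (fun i => (comp_mem_HolMaps (hΨ i) (hF i)).1)
      (fun i z hz => hM _ ((hΨ i).2.1 ((hF i).2.1 hz))) hid
  obtain ⟨t, ht, hti⟩ := Metric.tendstoLocallyUniformlyOn_iff.1 hcomp.tendsto_fderiv 1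
    one_pos z₀ hz₀
  rw [hU.isOpen.nhdsWithin_eq hz₀] at ht
  obtain ⟨R, hR, hball⟩ := Metric.eventually_nhds_iff_ball.1
    (Filter.Eventually.and ht (hU.isOpen.mem_nhds hz₀))
  have hhalf : ball z₀ (R / 2) ⊆ ball z₀ R := ball_subset_ball (by linarith)
  have hnz : ∀ᶠ i in (l : Filter ℕ), ∀ z ∈ ball z₀ (R / 2), (fderiv ℂ (F i) z).det ≠ 0 := by
    filter_upwards [hti] with i hi z hz
    have hzU := (hball z (hhalf hz)).2
    have h1 := hi z (hball z (hhalf hz)).1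
    rw [fderiv_id, dist_eq_norm] at h1
    have h2 := clm_det_ne_zero_of_isUnit (isUnit_one_sub_of_norm_lt_one h1)
    have h3 : (1 : Cn n →L[ℂ] Cn n) - (ContinuousLinearMap.id ℂ (Cn n) - fderiv ℂ (Ψ i ∘ F i) z)
        = fderiv ℂ (Ψ i ∘ F i) z := sub_sub_cancel _ _
    rw [h3, fderiv_comp_of_mapsTo hU.isOpen hV.isOpen (hΨ i).1 (hF i).1 (hF i).2.1 hzU,
      clm_det_mul] at h2
    exact right_ne_zero_of_mul h2
  have hdd : ∀ g : Cn n → Cn n, DifferentiableOn ℂ g U →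
      DifferentiableOn ℂ (fun z => (fderiv ℂ g z).det) U := fun g hg z hz =>
    (DifferentiableAt.comp z (differentiable_clm_det (fderiv ℂ g z))
      (differentiableAt_fderiv hU.isOpen hg hz)).differentiableWithinAt
  -- Otherwise the identity theorem would carry the vanishing of det f' from this ball to P.
  obtain ⟨u, hu, hDu⟩ : ∃ u ∈ ball z₀ (R / 2), (fderiv ℂ f u).det ≠ 0 := by
    by_contra! hcon
    refine hdet (eqOn_zero_of_eventuallyEq_zero hU.isOpen hU.isConnected.isPreconnected
      (hdd f hf.differentiableOn) hz₀ ?_ P hP)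
    filter_upwards [ball_mem_nhds z₀ (half_pos hR)] with u hu using hcon u hu
  have : ProperSpace (Cn n →L[ℂ] Cn n) := FiniteDimensional.proper ℂ _
  obtain ⟨K, hK⟩ := (isCompact_closedBall (0 : Cn n →L[ℂ] Cn n)
    (4 * M' / R)).exists_bound_of_continuousOn differentiable_clm_det.continuous.continuousOn
  have hDz₀ : (fderiv ℂ f z₀).det ≠ 0 :=
    apply_center_ne_zero_of_tendsto l (d := fun i z => (fderiv ℂ (F i) z).det) (M := K)
      (g := fun z => (fderiv ℂ f z).det)
      (fun i => (hdd _ (hF i).1).mono fun z hz => (hball z (hhalf hz)).2)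
      (fun i z hz => hK _ (mem_closedBall_zero_iff.2
        (norm_fderiv_le_of_mem_half_ball hR ((hF i).1.mono fun z hz => (hball z hz).2)
          (fun z hz => hM' _ ((hF i).2.1 (hball z hz).2)) hz)))
      (fun z hz => (differentiable_clm_det.continuous.tendsto _).comp
        (hf.tendsto_fderiv_at (hball z (hhalf hz)).2)) hnz hu hDu
  obtain ⟨i, w, hw, hwi⟩ :=
    (eventually_mem_image_of_isHolLimit hU.isOpen (fun i => (hF i).1) hf hz₀ hDz₀).exists
  exact hwi ▸ (hF i).2.1 hw

theorem biholomorphic_of_HolMaps_fderiv_near_one (hU : IsBoundedDomain U) (hV : IsBoundedDomain V)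
    (hP : P ∈ U) (hQ : Q ∈ V)
    (hnear : ∀ ε : ℝ, 0 < ε → ∃ φ ∈ HolMaps U V P Q, ∃ ψ ∈ HolMaps V U Q P,
      ‖fderiv ℂ ψ Q * fderiv ℂ φ P - 1‖ < ε) : Biholomorphic U V := by
  obtain ⟨M, hM⟩ := hU.exists_norm_le
  obtain ⟨M', hM'⟩ := hV.exists_norm_le
  choose F hF Ψ hΨ hlt using fun i : ℕ => hnear (1 / ((i : ℝ) + 1)) (by positivity)
  let l : Ultrafilter ℕ := hyperfilter ℕ
  have hlim : Tendsto (fun i => fderiv ℂ (Ψ i) Q * fderiv ℂ (F i) P) l (𝓝 1) := by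
    rw [tendsto_iff_norm_sub_tendsto_zero]
    exact (squeeze_zero (fun i => norm_nonneg _) (fun i => (hlt i).le)
      tendsto_one_div_add_atTop_nhds_zero_nat).mono_left Nat.hyperfilter_le_atTop
  obtain ⟨f, hf⟩ := exists_isHolLimit l hU.isOpen (fun i => (hF i).1)
    (fun i z hz => hM' _ ((hF i).2.1 hz))
  obtain ⟨g, hg⟩ := exists_isHolLimit l hV.isOpen (fun i => (hΨ i).1)
    (fun i z hz => hM _ ((hΨ i).2.1 hz))
  have hgf : fderiv ℂ g Q * fderiv ℂ f P = 1 :=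
    tendsto_nhds_unique ((hg.tendsto_fderiv_at hQ).mul (hf.tendsto_fderiv_at hP)) hlim
  have hmul : (fderiv ℂ g Q).det * (fderiv ℂ f P).det = 1 := by
    rw [← clm_det_mul, hgf, clm_det_one]
  have hfdet : (fderiv ℂ f P).det ≠ 0 := right_ne_zero_of_mul_eq_one hmul
  have hgdet : (fderiv ℂ g Q).det ≠ 0 := left_ne_zero_of_mul_eq_one hmul
  -- In finite dimension a one-sided inverse is two-sided, so Cartan applies to F i ∘ Ψ i on V as
  -- well.
  have hfg : fderiv ℂ f P * fderiv ℂ g Q = 1 := by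
    obtain ⟨a, ha⟩ := isUnit_clm_of_det_ne_zero hfdet
    rw [← ha] at hgf ⊢
    rw [Units.mul_eq_one_iff_eq_inv.1 hgf, Units.mul_inv]
  have hΨF : ∀ z ∈ U, Tendsto (fun i => Ψ i (F i z)) l (𝓝 z) := by
    have hm : ∀ i, Ψ i ∘ F i ∈ HolMaps U U P P := fun i => comp_mem_HolMaps (hΨ i) (hF i)
    refine tendsto_self_of_tendsto_fderiv_one l hU.isOpen hU.isConnected.isPreconnected hM hP
      (h := fun i => Ψ i ∘ F i) (fun i => (hm i).1) (fun i => (hm i).2.1) (fun i => (hm i).2.2) ?_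
    simpa only [fderiv_comp_HolMaps hU.isOpen hV.isOpen (hΨ _) (hF _) hP] using hlim
  have hFΨ : ∀ z ∈ V, Tendsto (fun i => F i (Ψ i z)) l (𝓝 z) := by
    have hm : ∀ i, F i ∘ Ψ i ∈ HolMaps V V Q Q := fun i => comp_mem_HolMaps (hF i) (hΨ i)
    refine tendsto_self_of_tendsto_fderiv_one l hV.isOpen hV.isConnected.isPreconnected hM' hQ
      (h := fun i => F i ∘ Ψ i) (fun i => (hm i).1) (fun i => (hm i).2.1) (fun i => (hm i).2.2) ?_
    simp only [fderiv_comp_HolMaps hV.isOpen hU.isOpen (hF _) (hΨ _) hQ]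
    exact hfg ▸ (hf.tendsto_fderiv_at hP).mul (hg.tendsto_fderiv_at hQ)
  have hfm := mapsTo_of_isHolLimit l hU hV hP hF hΨ hΨF hf hfdet
  have hgm := mapsTo_of_isHolLimit l hV hU hQ hΨ hF hFΨ hg hgdet
  exact ⟨f, g, hf.differentiableOn, hg.differentiableOn, hfm, hgm,
    fun z hz => tendsto_nhds_unique
      (hg.tendsto_comp hV.isOpen (hfm hz) (hf.tendsto_at hz)) (hΨF z hz),
    fun z hz => tendsto_nhds_unique
      (hf.tendsto_comp hU.isOpen (hgm hz) (hg.tendsto_at hz)) (hFΨ z hz)⟩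

/-- If every product of Jacobians were below s, then C ≤ s K = s C, which is impossible for 0 < C <
∞. -/
theorem exists_det_of_quotientInvariant_eq_one
    (h : quotientInvariant V Q U P = 1) {s : ℝ} (hs0 : 0 < s) (hs1 : s < 1) :
    ∃ φ ∈ HolMaps U V P Q, ∃ ψ ∈ HolMaps V U Q P, s ≤ ‖(fderiv ℂ ψ Q * fderiv ℂ φ P).det‖ := by
  rw [quotientInvariant] at h
  set C := caratheodoryVol V Q U P with hC
  set K := kobayashiVol V Q U P with hK
  -- The conventions 0 / 0 = 0, K / 0 = ∞ for K ≠ 0, and K / ∞ = 0 exclude degenerate C.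
  have hC0 : C ≠ 0 := by
    intro h0
    rw [h0] at h
    rcases eq_or_ne K 0 with hK0 | hK0
    · simp [hK0] at h
    · simp [ENNReal.div_zero hK0] at h
  have hCtop : C ≠ ⊤ := by
    intro h0
    simp [h0] at h
  have hKC : K = C := (ENNReal.div_eq_one_iff hC0 hCtop).1 h
  by_contra! hcon
  have ha0 : ENNReal.ofReal s ≠ 0 := by simpa using hs0
  have hle : C ≤ ENNReal.ofReal s * C := by
    conv_lhs => rw [hC, caratheodoryVol]
    refine iSup₂_le fun φ hφ => ?_
    rw [← ENNReal.div_le_iff' ha0 ENNReal.ofReal_ne_top, ← hKC, hK, kobayashiVol]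
    refine le_iInf₂ fun ψ hψ => ?_
    rw [ENNReal.div_le_iff' ha0 ENNReal.ofReal_ne_top, mul_one_div,
      ENNReal.le_div_iff_mul_le (Or.inr ha0) (Or.inr ENNReal.ofReal_ne_top)]
    have := (hcon φ hφ ψ hψ).le
    rw [clm_det_mul, norm_mul, mul_comm] at this
    simp only [absJacobian]
    rw [← enorm_mul, ← ofReal_norm, norm_mul]
    exact ENNReal.ofReal_le_ofReal this
  have hlt : ENNReal.ofReal s * C < 1 * C :=
    ENNReal.mul_lt_mul_left hC0 hCtop (by simpa using hs1)
  rw [one_mul] at hlt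
  exact hlt.not_ge hle

end HolMaps

end ModelDomain

theorem mainTheorem8 (n : ℕ) (𝓑 : Set (ModelDomain.Cn n)) (h𝓑 : ModelDomain.IsBoundedDomain 𝓑)
    (P₀ : ModelDomain.Cn n) (hP₀ : P₀ ∈ 𝓑)
    (Ω : Set (ModelDomain.Cn n)) (hΩ : ModelDomain.IsBoundedDomain Ω)
    (h : ∃ P ∈ Ω, ModelDomain.quotientInvariant 𝓑 P₀ Ω P = 1) :
    ModelDomain.Biholomorphic Ω 𝓑 := by
  obtain ⟨P, hP, hquot⟩ := h
  exact ModelDomain.biholomorphic_of_HolMaps_fderiv_near_one hΩ h𝓑 hP hP₀ fun ε hε =>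
    ModelDomain.exists_HolMaps_fderiv_near_one hΩ h𝓑.isOpen hP
      (fun s hs0 hs1 => ModelDomain.exists_det_of_quotientInvariant_eq_one hquot hs0 hs1) hε
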